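/- Let $G$ be a countably infinite discrete abelian group with identity $e$, let $\widehat{G}$ be its Pontryagin dual (the compact group of all characters $\chi:G\to\mathbb{S}^1$), with trivial character denoted $0$, and for a Borel probability measure $\mu$ on $\widehat{G}$ put $\hat\mu(g)=\int_{\widehat{G}}\chi(g)\,d\mu(\chi)$ for $g\in G$. A unitary representation $\pi$ of $G$ is a homomorphism from $G$ to the unitary group of a complex Hilbert space $\mathcal{H}_\pi$; an eigenvector of $\pi$ is a nonzero $\eta\in\mathcal{H}_\pi$ for which there is $\chi\in\widehat{G}$ with $\pi(g)\eta=\chi(g)\eta$ for all $g\in G$. Let $V\subseteq G$ with $e\notin V$. The following are equivalent: (i) $V$ is a set of operatorial recurrence, i.e., for every unitary representation $\pi$ of $G$ and every $\xi\in\mathcal{H}_\pi$ with $\langle\pi(v)\xi,\xi\rangle=0$ for all $v\in V$, the vector $\xi$ is orthogonal to the subspace of $\pi(G)$-invariant vectors. (ii) Every Borel probability measure $\mu$ on $\widehat{G}$ with $\hat\mu(v)=0$ for all $v\in V$ satisfies $\mu(\{0\})=0$. (iii) For every unitary representation $\pi$ of $G$ and every $\xi\in\mathcal{H}_\pi$,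 if $\sum_{v\in V}|\langle\pi(v)\xi,\xi\rangle|^p<\infty$ for some integer $p\ge 1$, then $\xi$ is orthogonal to all eigenvectors of $\pi$. (iv) Every Borel probability measure $\mu$ on $\widehat{G}$ with $\sum_{v\in V}|\hat\mu(v)|^p<\infty$ for some integer $p\ge 1$ is continuous, i.e., $\mu(\{\chi\})=0$ for every $\chi\in\widehat{G}$. -/

import Mathlib

universe u v

/-- The Borel `σ`-algebra on the Pontryagin dual. -/
noncomputable instance PontryaginDual.instMeasurableSpaceBorel (G : Type u) [CommGroup G]
    [TopologicalSpace G] :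
    MeasurableSpace (PontryaginDual G) :=
  borel (PontryaginDual G)

instance PontryaginDual.instBorelSpace (G : Type u) [CommGroup G] [TopologicalSpace G] :
    BorelSpace (PontryaginDual G) :=
  ⟨rfl⟩

namespace OperatorialRecurrence

/-- A unitary representation of the discrete group `G` on the complex Hilbert space `H`. -/
abbrev UnitaryRep (G : Type u) [CommGroup G] (H : Type v) [NormedAddCommGroup H]
    [InnerProductSpace ℂ H] [CompleteSpace H] : Type (max u v) :=
  G →* unitary (H →L[ℂ] H)

/-- The matrix coefficient `⟨π(g)ξ, ξ⟩`, linear in `π(g)ξ`. (The inner product `inner ℂ x y` of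
Mathlib is linear in its second argument `y`.) -/
noncomputable def matrixCoeff {G : Type u} [CommGroup G] {H : Type v} [NormedAddCommGroup H]
    [InnerProductSpace ℂ H] [CompleteSpace H] (π : UnitaryRep G H) (ξ : H) (g : G) : ℂ :=
  inner ℂ ξ ((π g : H →L[ℂ] H) ξ)

/-- `η` is a `π(G)`-invariant vector. -/
def IsInvariantVector {G : Type u} [CommGroup G] {H : Type v} [NormedAddCommGroup H]
    [InnerProductSpace ℂ H] [CompleteSpace H] (π : UnitaryRep G H) (η : H) : Prop :=
  ∀ g : G, (π g : H →L[ℂ] H) η = η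

/-- `η` is an eigenvector of `π`: it is nonzero and `π(g)η = χ(g)η` for all `g`, for some
character `χ` of `G`. -/
def IsEigenvector {G : Type u} [CommGroup G] [TopologicalSpace G] {H : Type v}
    [NormedAddCommGroup H] [InnerProductSpace ℂ H] [CompleteSpace H]
    (π : UnitaryRep G H) (η : H) : Prop :=
  η ≠ 0 ∧ ∃ χ : PontryaginDual G, ∀ g : G, (π g : H →L[ℂ] H) η = (χ g : ℂ) • η

/-- `V` is a set of operatorial recurrence: for every unitary representation `π` of `G` and every
vector `ξ` with `⟨π(v)ξ, ξ⟩ = 0` for all `v ∈ V`, the vector `ξ` is orthogonal to the subspace of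
`π(G)`-invariant vectors. -/
def IsSetOfOperatorialRecurrence {G : Type u} [CommGroup G] (V : Set G) : Prop :=
  ∀ (H : Type v) [NormedAddCommGroup H] [InnerProductSpace ℂ H] [CompleteSpace H]
    (π : UnitaryRep G H) (ξ : H),
    (∀ g ∈ V, matrixCoeff π ξ g = 0) → ∀ η : H, IsInvariantVector π η → inner ℂ ξ η = 0

/-- The Fourier transform `μ̂(g) = ∫ χ(g) dμ(χ)` of a measure on the dual group. -/
noncomputable def fourierTransform {G : Type u} [CommGroup G] [TopologicalSpace G]
    (μ : MeasureTheory.Measure (PontryaginDual G)) (g : G) : ℂ :=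
  ∫ χ, (χ g : ℂ) ∂μ

end OperatorialRecurrence

/-! Vectors and measures are two views of the same object: `exists_spectralMeasure` turns matrix
coefficients into Fourier transforms, and `exists_unitaryRep_matrixCoeff_eq` goes back, with the
constant 1 in `L²(μ)` as vector and the indicator of the trivial character as invariant vector. This
gives (i) → (ii) and, once an eigenvector not orthogonal to `ξ` is seen to produce an atom, (iv) →
(iii); (iii) → (i) is a special case.

The substance is (ii) → (iv), by contraposition. Let `μ` have an atom and a `p`-summable transform
on `V`. Translate the atom to the trivial character and take the `p`-th convolution power: the atom
survives and the transform becomes absolutely summable on `V`. Its restriction `b` to `V ∪ V⁻¹` is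
then the coefficient family of a continuous real function `D`, bounded by `c = ∑ ‖b g‖`. Adding the
positive measure `(c - D) dm`, with `m` Haar, subtracts `b` from the transform away from the
identity, so it vanishes on `V`, and cannot destroy the atom. -/

open MeasureTheory OperatorialRecurrence

/-! ### Spectral measures via Gelfand duality and Riesz representation. -/

/-- Riesz representation of positive functionals on commutative `C⋆`-algebras. -/
theorem CommCStarAlgebra.exists_measure_characterSpace {A : Type*} [CommCStarAlgebra A]
    [MeasurableSpace (WeakDual.characterSpace ℂ A)] [BorelSpace (WeakDual.characterSpace ℂ A)]
    (L : A →ₗ[ℂ] ℂ) (hstar : ∀ a, L (star a) = star (L a))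
    (hpos : ∀ a, 0 ≤ (L (star a * a)).re) :
    ∃ μ : Measure (WeakDual.characterSpace ℂ A), IsFiniteMeasure μ ∧
      ∀ a, ∫ φ, φ a ∂μ = L a := by
  let X := WeakDual.characterSpace ℂ A
  let e := gelfandStarTransform A
  let lift : C(X, ℝ) → C(X, ℂ) := fun f => ⟨fun x => (f x : ℂ), by fun_prop⟩
  have hadd (f g : C(X, ℝ)) : lift (f + g) = lift f + lift g := by ext; simp [lift]
  have hsmul (c : ℝ) (f : C(X, ℝ)) : lift (c • f) = (c : ℂ) • lift f := by ext; simp [lift]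
  let l : C(X, ℝ) → ℝ := fun f => (L (e.symm (lift f))).re
  let Λ₀ : CompactlySupportedContinuousMap X ℝ →ₗ[ℝ] ℝ :=
    { toFun f := l f.toContinuousMap
      map_add' f g := by
        change l (f.toContinuousMap + g.toContinuousMap) = _
        simp [l, hadd]
      map_smul' c f := by
        change l (c • f.toContinuousMap) = _
        simp [l, hsmul] }
  have hΛ₀ : ∀ f : CompactlySupportedContinuousMap X ℝ, 0 ≤ f → 0 ≤ Λ₀ f := by
    intro f hf
    let g : C(X, ℝ) := ⟨fun x => Real.sqrt (f x), by fun_prop⟩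
    have hfg : lift f.toContinuousMap = star (lift g) * lift g := by
      ext x
      have : 0 ≤ f x := hf x
      simp only [lift, g, ContinuousMap.coe_mk, ContinuousMap.mul_apply, ContinuousMap.star_apply,
        RCLike.star_def, Complex.conj_ofReal, ← Complex.ofReal_mul, Real.mul_self_sqrt this]
      rfl
    change 0 ≤ (L (e.symm (lift f.toContinuousMap))).re
    rw [hfg, map_mul, map_star]
    exact hpos _
  let Λ := PositiveLinearMap.mk₀ Λ₀ hΛ₀
  refine ⟨RealRMK.rieszMeasure Λ, inferInstance, fun a => ?_⟩
  have hreal (f : C(X, ℝ)) : ((∫ x, f x ∂(RealRMK.rieszMeasure Λ) : ℝ) : ℂ)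
      = L (e.symm (lift f)) := by
    have h := RealRMK.integral_rieszMeasure Λ
      (CompactlySupportedContinuousMap.continuousMapEquiv f)
    have h1 : ∫ x, f x ∂(RealRMK.rieszMeasure Λ) = (L (e.symm (lift f))).re := h
    rw [h1]
    have h2 : star (L (e.symm (lift f))) = L (e.symm (lift f)) := by
      rw [← hstar, ← map_star]
      congr 2
      ext x
      simp [lift]
    exact Complex.conj_eq_iff_re.mp h2
  let F : C(X, ℂ) := e a
  let u : C(X, ℝ) := ⟨fun x => (F x).re, by fun_prop⟩
  let w : C(X, ℝ) := ⟨fun x => (F x).im, by fun_prop⟩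
  have hF : F = lift u + Complex.I • lift w := by
    ext x
    simp only [lift, u, w, ContinuousMap.coe_mk, ContinuousMap.add_apply, ContinuousMap.smul_apply,
      smul_eq_mul]
    rw [mul_comm, Complex.re_add_im]
  have hL : L a = L (e.symm (lift u)) + Complex.I * L (e.symm (lift w)) := by
    have : a = e.symm F := by simp [F]
    rw [this, hF]
    simp
  have hint (f : C(X, ℂ)) : Integrable f (RealRMK.rieszMeasure Λ) :=
    f.continuous.integrable_of_hasCompactSupport (HasCompactSupport.of_compactSpace _)
  have hFa : ∫ φ, φ a ∂(RealRMK.rieszMeasure Λ) = ∫ φ, F φ ∂(RealRMK.rieszMeasure Λ) := rfl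
  rw [hL, ← hreal u, ← hreal w, hFa, ← integral_re_add_im (hint F), mul_comm]
  rfl

theorem PontryaginDual.continuous_coe_apply {G : Type u} [CommGroup G] [TopologicalSpace G]
    (g : G) : Continuous fun χ : PontryaginDual G => (χ g : ℂ) :=
  continuous_subtype_val.comp <|
    ContinuousEvalConst.continuous_eval_const (F := G →ₜ* Circle) g

/-- Every vector of a unitary representation has a spectral measure on the dual group. -/
theorem exists_spectralMeasure {G : Type u} [CommGroup G] [TopologicalSpace G]
    [DiscreteTopology G] {H : Type v} [NormedAddCommGroup H]
    [InnerProductSpace ℂ H] [CompleteSpace H] (π : UnitaryRep G H) (ξ : H) :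
    ∃ μ : Measure (PontryaginDual G), IsFiniteMeasure μ ∧
      ∀ g, fourierTransform μ g = matrixCoeff π ξ g := by
  let s : Set (H →L[ℂ] H) := Set.range fun g => (π g : H →L[ℂ] H)
  have hstar : star s = s := by
    ext x
    constructor
    · rintro ⟨g, hg⟩
      refine ⟨g⁻¹, ?_⟩
      have : x = star (π g : H →L[ℂ] H) := by rw [← star_star x]; exact congrArg star hg.symm
      simp only [this, map_inv]
      rfl
    · rintro ⟨g, rfl⟩
      exact ⟨g⁻¹, by simp only [map_inv]; rfl⟩
  have hcomm : ∀ a ∈ s, ∀ b ∈ s, a * b = b * a := by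
    rintro _ ⟨g, rfl⟩ _ ⟨h, rfl⟩
    exact congrArg Subtype.val (show π g * π h = π h * π g by rw [← map_mul, mul_comm, map_mul])
  -- The double commutant of `π(G)` serves as the commutative C⋆-algebra: it is closed and contains
  -- `π(G)`, and it is commutative because `π(G)` is.
  let S := StarSubalgebra.centralizer ℂ (StarSubalgebra.centralizer ℂ s : Set (H →L[ℂ] H))
  have hS : (S : Set (H →L[ℂ] H)) = s.centralizer.centralizer := by
    rw [StarSubalgebra.coe_centralizer_centralizer, hstar, Set.union_self]
  have hclosed : IsClosed (S : Set (H →L[ℂ] H)) := by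
    rw [hS]; exact Set.isClosed_centralizer _
  let _ : CStarAlgebra S := StarSubalgebra.cstarAlgebra S (h_closed := hclosed)
  let _ : CommCStarAlgebra S :=
    { mul_comm := fun x y => Subtype.ext <|
        Set.centralizer_centralizer_comm_of_comm hcomm _ (hS ▸ x.2) _ (hS ▸ y.2) }
  have hmem (g : G) : (π g : H →L[ℂ] H) ∈ S := by
    change _ ∈ (S : Set (H →L[ℂ] H))
    rw [hS]
    exact Set.subset_centralizer_centralizer ⟨g, rfl⟩
  let p (g : G) : S := ⟨π g, hmem g⟩
  have hp1 : p 1 = 1 := Subtype.ext (by simp [p])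
  have hpmul (g h : G) : p (g * h) = p g * p h := Subtype.ext (by simp [p])
  have hpstar (g : G) : star (p g) * p g = 1 := Subtype.ext (by simp [p])
  let L : S →ₗ[ℂ] ℂ :=
    { toFun a := inner ℂ ξ ((a : H →L[ℂ] H) ξ)
      map_add' a b := by simp
      map_smul' c a := by simp }
  let _ : MeasurableSpace (WeakDual.characterSpace ℂ S) := borel _
  have _ : BorelSpace (WeakDual.characterSpace ℂ S) := ⟨rfl⟩
  obtain ⟨ν, hν, hνL⟩ := CommCStarAlgebra.exists_measure_characterSpace L
    (fun a => by
      change inner ℂ ξ ((star (a : H →L[ℂ] H)) ξ) = star (inner ℂ ξ ((a : H →L[ℂ] H) ξ))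
      rw [ContinuousLinearMap.star_eq_adjoint, ContinuousLinearMap.adjoint_inner_right]
      exact (inner_conj_symm _ _).symm)
    (fun a => by
      change 0 ≤ (inner ℂ ξ ((star (a : H →L[ℂ] H) * (a : H →L[ℂ] H)) ξ)).re
      rw [ContinuousLinearMap.star_eq_adjoint, mul_apply_eq_comp,
        ContinuousLinearMap.adjoint_inner_right]
      exact inner_self_nonneg (𝕜 := ℂ))
  have hnorm (φ : WeakDual.characterSpace ℂ S) (g : G) : ‖φ (p g)‖ = 1 := by
    have h1 : star (φ (p g)) * φ (p g) = 1 := by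
      rw [← map_star, ← map_mul, hpstar, map_one]
    have h2 := congrArg norm h1
    rw [norm_mul, norm_star, norm_one] at h2
    nlinarith [norm_nonneg (φ (p g))]
  let c (φ : WeakDual.characterSpace ℂ S) : PontryaginDual G :=
    (⟨⟨⟨fun g => ⟨φ (p g), mem_sphere_zero_iff_norm.2 (hnorm φ g)⟩,
      Circle.ext (by simp [hp1])⟩, fun g h =>
        Circle.ext ((congrArg φ (hpmul g h)).trans (map_mul φ _ _))⟩,
      continuous_of_discreteTopology⟩ : G →ₜ* Circle)
  have hc (φ : WeakDual.characterSpace ℂ S) (g : G) : (c φ g : ℂ) = φ (p g) := rfl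
  have hcont : Continuous c := by
    refine (ContinuousMonoidHom.isInducing_toContinuousMap G Circle).continuous_iff.2 ?_
    refine ContinuousMap.continuous_of_continuous_uncurry _ ?_
    -- Since `G` is discrete, continuity into the compact-open topology reduces to continuity of
    -- each evaluation at `g`.
    refine continuous_prod_of_discrete_right.2 fun g => ?_
    refine Continuous.subtype_mk ?_ _
    exact (WeakDual.eval_continuous (p g)).comp continuous_subtype_val
  refine ⟨ν.map c, inferInstance, fun g => ?_⟩
  rw [fourierTransform, integral_map hcont.measurable.aemeasurable
    (PontryaginDual.continuous_coe_apply g).aestronglyMeasurable]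
  exact hνL (p g)

/-! ### Multiplication representations on `L²`. -/

/-- A norm-preserving action of a group by bounded operators is a unitary representation. -/
noncomputable def OperatorialRecurrence.UnitaryRep.ofNormMap {G : Type u} [CommGroup G] {H : Type v}
    [NormedAddCommGroup H] [InnerProductSpace ℂ H] [CompleteSpace H] (ρ : G →* (H →L[ℂ] H))
    (hρ : ∀ g x, ‖ρ g x‖ = ‖x‖) : UnitaryRep G H :=
  ρ.codRestrict (unitary (H →L[ℂ] H)) fun g => by
    have h1 : star (ρ g) * ρ g = 1 :=
      (ContinuousLinearMap.norm_map_iff_adjoint_comp_self (ρ g)).1 (hρ g)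
    -- An isometry need not be onto; the group inverse supplies the right inverse, which must equal
    -- the adjoint.
    have h2 : ρ g * ρ g⁻¹ = 1 := by rw [← map_mul, mul_inv_cancel, map_one]
    refine ⟨h1, ?_⟩
    rwa [left_inv_eq_right_inv h1 h2]

section Multiplication

variable {X : Type v} [MeasurableSpace X] (ν : Measure X)

theorem MeasureTheory.MemLp.circle_mul {ν : Measure X} {c : X → Circle}
    (hc : Measurable fun x => (c x : ℂ))
    {f : X → ℂ}
    (hf : MemLp f 2 ν) : MemLp (fun x => (c x : ℂ) * f x) 2 ν :=
  hf.of_le (hc.aestronglyMeasurable.mul hf.1)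
    (.of_forall fun x => by rw [norm_mul, Circle.norm_coe, one_mul])

/-- Multiplication by a circle-valued function on `L²`. -/
noncomputable def MeasureTheory.Lp.circleMul (c : X → Circle)
    (hc : Measurable fun x => (c x : ℂ)) :
    Lp ℂ 2 ν →ₗᵢ[ℂ] Lp ℂ 2 ν where
  toFun f := ((Lp.memLp f).circle_mul hc).toLp
  map_add' f g := by
    rw [← MemLp.toLp_add]
    refine MemLp.toLp_congr _ _ ?_
    filter_upwards [Lp.coeFn_add f g] with x hx
    rw [hx, Pi.add_apply, mul_add, Pi.add_apply]
  map_smul' a f := by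
    rw [RingHom.id_apply, ← MemLp.toLp_const_smul]
    refine MemLp.toLp_congr _ _ ?_
    filter_upwards [Lp.coeFn_smul a f] with x hx
    simp [hx, mul_left_comm]
  norm_map' f := by
    change ‖((Lp.memLp f).circle_mul hc).toLp‖ = _
    rw [Lp.norm_toLp, Lp.norm_def]
    exact congrArg _ (eLpNorm_congr_norm_ae
      (.of_forall fun x => by rw [norm_mul, Circle.norm_coe, one_mul]))

theorem MeasureTheory.Lp.circleMul_toLp {c : X → Circle}
    (hc : Measurable fun x => (c x : ℂ)) {f : X → ℂ}
    (hf : MemLp f 2 ν) : Lp.circleMul ν c hc hf.toLp = (hf.circle_mul hc).toLp := by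
  refine MemLp.toLp_congr ((Lp.memLp hf.toLp).circle_mul hc) _ ?_
  filter_upwards [hf.coeFn_toLp] with x hx
  rw [hx]

/-- The representation on `L²` given by multiplication with a homomorphism into circle-valued
functions. -/
noncomputable def OperatorialRecurrence.mulRep {G : Type u} [CommGroup G] (c : G →* (X → Circle))
    (hc : ∀ g, Measurable fun x => (c g x : ℂ)) : UnitaryRep G (Lp ℂ 2 ν) :=
  UnitaryRep.ofNormMap
    { toFun g := (Lp.circleMul ν (c g) (hc g)).toContinuousLinearMap
      map_one' := by
        ext1 f
        change (MemLp.circle_mul (hc 1) (Lp.memLp f)).toLp = f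
        conv_rhs => rw [← Lp.toLp_coeFn f (Lp.memLp f)]
        exact MemLp.toLp_congr _ _ (.of_forall fun x => by simp)
      map_mul' g h := by
        ext1 f
        change (MemLp.circle_mul (hc (g * h)) (Lp.memLp f)).toLp =
          Lp.circleMul ν (c g) (hc g) ((MemLp.circle_mul (hc h) (Lp.memLp f)).toLp)
        rw [Lp.circleMul_toLp]
        exact MemLp.toLp_congr _ _ (.of_forall fun x => by simp [mul_assoc]) }
    fun g f => (Lp.circleMul ν (c g) (hc g)).norm_map f

theorem OperatorialRecurrence.mulRep_toLp {G : Type u} [CommGroup G] (c : G →* (X → Circle))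
    (hc : ∀ g, Measurable fun x => (c g x : ℂ)) (g : G) {f : X → ℂ} (hf : MemLp f 2 ν) :
    (mulRep ν c hc g : Lp ℂ 2 ν →L[ℂ] Lp ℂ 2 ν) hf.toLp = (hf.circle_mul (hc g)).toLp :=
  Lp.circleMul_toLp ν (hc g) hf

theorem MeasureTheory.L2.inner_toLp_toLp {ν : Measure X} {f g : X → ℂ} (hf : MemLp f 2 ν)
    (hg : MemLp g 2 ν) : inner ℂ hf.toLp hg.toLp = ∫ x, inner ℂ (f x) (g x) ∂ν := by
  rw [L2.inner_def]
  refine integral_congr_ae ?_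
  filter_upwards [hf.coeFn_toLp, hg.coeFn_toLp] with x hx hx'
  rw [hx, hx']

end Multiplication

/-- Makes multiplication on the dual jointly measurable, as convolution of measures requires. -/
instance PontryaginDual.instSecondCountableTopology {G : Type u} [CommGroup G] [TopologicalSpace G]
    [DiscreteTopology G] [Countable G] : SecondCountableTopology (PontryaginDual G) :=
  (ContinuousMonoidHom.isInducing_toContinuousMap G Circle).secondCountableTopology

instance PontryaginDual.small {G : Type u} [CommGroup G] [TopologicalSpace G]
    [Countable G] : Small.{v} (PontryaginDual G) :=
  small_of_injective (β := G → Circle) (f := fun χ g => χ g) DFunLike.coe_injective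

/-- Every finite measure on the dual group is the spectral measure of a vector in some unitary
representation on a Hilbert space in a given universe; the mass of the trivial character is the
inner product of this vector with an invariant one. -/
theorem exists_unitaryRep_matrixCoeff_eq {G : Type u} [CommGroup G] [TopologicalSpace G]
    [DiscreteTopology G] [Countable G] (μ : Measure (PontryaginDual G)) [IsFiniteMeasure μ] :
    ∃ (H : Type v) (_ : NormedAddCommGroup H) (_ : InnerProductSpace ℂ H) (_ : CompleteSpace H)
      (π : UnitaryRep G H) (ξ η : H), (∀ g, matrixCoeff π ξ g = fourierTransform μ g) ∧
        IsInvariantVector π η ∧ inner ℂ ξ η = (μ.real {1} : ℂ) := by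
  -- The dual lives in universe `u` but the Hilbert space must live in `v`, so `L²` is formed over a
  -- copy of the dual in `v`.
  let X := Shrink.{v} (PontryaginDual G)
  let e : PontryaginDual G ≃ X := equivShrink _
  let _ : MeasurableSpace X := MeasurableSpace.comap e.symm inferInstance
  have he' : Measurable e.symm := comap_measurable _
  have he : Measurable e := measurable_comap_iff.2 (by
    convert measurable_id
    exact funext e.symm_apply_apply)
  let ν : Measure X := μ.map e
  let c : G →* (X → Circle) :=
    { toFun g x := e.symm x g
      map_one' := funext fun x => map_one _
      map_mul' g h := funext fun x => map_mul _ g h }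
  have hc (g : G) : Measurable fun x => (c g x : ℂ) :=
    (PontryaginDual.continuous_coe_apply g).measurable.comp he'
  have h1 : MemLp (fun _ => 1 : X → ℂ) 2 ν := memLp_const 1
  have hs : MeasurableSet {e 1} := by
    refine ⟨{1}, measurableSet_singleton _, ?_⟩
    ext x
    simp [Equiv.symm_apply_eq]
  have h2 : MemLp (Set.indicator {e 1} fun _ => 1 : X → ℂ) 2 ν := h1.indicator hs
  refine ⟨Lp ℂ 2 ν, inferInstance, inferInstance, inferInstance, mulRep ν c hc, h1.toLp, h2.toLp,
    fun g => ?_, fun g => ?_, ?_⟩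
  · rw [matrixCoeff, mulRep_toLp, L2.inner_toLp_toLp, fourierTransform]
    have := integral_map (μ := μ) he.aemeasurable (f := fun x => (c g x : ℂ))
      (hc g).aestronglyMeasurable
    simpa [c] using this
  · rw [mulRep_toLp]
    refine MemLp.toLp_congr _ _ (.of_forall fun x => ?_)
    by_cases hx : x = e 1
    · simp [hx, c]
    · simp [hx]
  · rw [L2.inner_toLp_toLp]
    have : ∀ x, inner ℂ (1 : ℂ) (Set.indicator {e 1} (fun _ => (1 : ℂ)) x) =
        Set.indicator {e 1} (fun _ => (1 : ℂ)) x := fun x => by simp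
    simp only [this]
    rw [integral_indicator_const _ hs, map_measureReal_apply he hs]
    have : e ⁻¹' {e 1} = {1} := by ext; simp
    simp [this]

/-- Characters of a discrete abelian group separate points. -/
theorem PontryaginDual.exists_apply_ne_one {G : Type u} [CommGroup G] [TopologicalSpace G]
    [DiscreteTopology G] {g : G} (hg : g ≠ 1) : ∃ χ : PontryaginDual G, χ g ≠ 1 := by
  obtain ⟨c, hc⟩ := CharacterModule.exists_character_apply_ne_zero_of_ne_zero
    (a := Additive.ofMul g) (by simpa using hg)
  -- The available separating character takes values in `ℚ/ℤ`; the embedding into `ℝ/ℤ` preserves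
  -- nontriviality.
  let f : AddCircle (1 : ℚ) →+ AddCircle (1 : ℝ) :=
    QuotientAddGroup.map _ _ (Rat.castHom ℝ).toAddMonoidHom (by
      rw [AddSubgroup.zmultiples_le, AddSubgroup.mem_comap]
      simp)
  have hf (x : AddCircle (1 : ℚ)) (hx : f x = 0) : x = 0 := by
    induction x using QuotientAddGroup.induction_on with
    | H q =>
      have hq : ((q : ℝ) : AddCircle (1 : ℝ)) = 0 := hx
      obtain ⟨n, hn⟩ := (AddCircle.coe_eq_zero_iff _).1 hq
      refine (AddCircle.coe_eq_zero_iff _).2 ⟨n, ?_⟩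
      rw [zsmul_one] at hn ⊢
      exact_mod_cast hn
  let χ : G →ₜ* Circle :=
    ⟨⟨⟨fun h => (f (c (Additive.ofMul h))).toCircle, by simp⟩,
      fun h k => by simp [AddCircle.toCircle_add]⟩, continuous_of_discreteTopology⟩
  refine ⟨χ, fun h => hc (hf _ (AddCircle.injective_toCircle one_ne_zero ?_))⟩
  rw [AddCircle.toCircle_zero]
  exact h

/-! ### Fourier transforms, atoms and convolution. -/

namespace OperatorialRecurrence

variable {G : Type u} [CommGroup G] [TopologicalSpace G]

theorem integrable_coe_apply (μ : Measure (PontryaginDual G)) [IsFiniteMeasure μ] (g : G) :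
    Integrable (fun χ : PontryaginDual G => (χ g : ℂ)) μ :=
  .of_bound (PontryaginDual.continuous_coe_apply g).aestronglyMeasurable 1
    (.of_forall fun _ => (Circle.norm_coe _).le)

theorem fourierTransform_add (μ ν : Measure (PontryaginDual G)) [IsFiniteMeasure μ]
    [IsFiniteMeasure ν] (g : G) :
    fourierTransform (μ + ν) g = fourierTransform μ g + fourierTransform ν g :=
  integral_add_measure (integrable_coe_apply μ g) (integrable_coe_apply ν g)

theorem fourierTransform_smul (r : ENNReal) (μ : Measure (PontryaginDual G)) (g : G) :
    fourierTransform (r • μ) g = r.toReal * fourierTransform μ g := by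
  rw [fourierTransform, integral_smul_measure, Complex.real_smul]
  rfl

theorem fourierTransform_dirac (χ : PontryaginDual G) (g : G) :
    fourierTransform (Measure.dirac χ) g = χ g :=
  integral_dirac _ _

theorem fourierTransform_inv (μ : Measure (PontryaginDual G)) (g : G) :
    fourierTransform μ g⁻¹ = star (fourierTransform μ g) := by
  rw [fourierTransform, fourierTransform, RCLike.star_def, ← integral_conj]
  simp only [map_inv, Circle.coe_inv_eq_conj]

theorem fourierTransform_map_mul_left (χ : PontryaginDual G) (μ : Measure (PontryaginDual G))
    (g : G) : fourierTransform (μ.map (χ * ·)) g = χ g * fourierTransform μ g := by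
  rw [fourierTransform, integral_map (continuous_const_mul χ).measurable.aemeasurable
    (PontryaginDual.continuous_coe_apply g).aestronglyMeasurable, fourierTransform,
    ← integral_const_mul]
  rfl

theorem fourierTransform_mconv [DiscreteTopology G] [Countable G]
    (μ ν : Measure (PontryaginDual G)) [IsFiniteMeasure μ] [IsFiniteMeasure ν] (g : G) :
    fourierTransform (μ.mconv ν) g = fourierTransform μ g * fourierTransform ν g := by
  rw [fourierTransform, integral_mconv (integrable_coe_apply _ g)]
  have (χ ψ : PontryaginDual G) : ((χ * ψ) g : ℂ) = χ g * ψ g := rfl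
  simp only [this, integral_const_mul, integral_mul_const]
  rfl

/-- The pair `(1, 1)` multiplies to 1, so atoms at the trivial character survive convolution. -/
theorem mul_le_mconv_singleton_one [DiscreteTopology G] [Countable G]
    (μ ν : Measure (PontryaginDual G)) [SFinite ν] :
    μ {1} * ν {1} ≤ μ.mconv ν {1} := by
  rw [← Measure.prod_prod, Measure.mconv,
    Measure.map_apply measurable_mul (measurableSet_singleton _)]
  refine measure_mono ?_
  rintro ⟨χ, ψ⟩ ⟨rfl, rfl⟩
  simp

theorem exists_fourierTransform_eq_pow [DiscreteTopology G] [Countable G]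
    (μ : Measure (PontryaginDual G)) [IsFiniteMeasure μ] (hμ : μ {1} ≠ 0) (p : ℕ) :
    ∃ ν : Measure (PontryaginDual G), IsFiniteMeasure ν ∧ ν {1} ≠ 0 ∧
      ∀ g, fourierTransform ν g = fourierTransform μ g ^ p := by
  induction p with
  | zero => exact ⟨Measure.dirac 1, inferInstance, by simp, fun g => by
      rw [fourierTransform_dirac]; simp⟩
  | succ p ih =>
    obtain ⟨ν, _, h1, h2⟩ := ih
    refine ⟨ν.mconv μ, inferInstance, fun h => ?_, fun g => ?_⟩
    · exact mul_ne_zero h1 hμ (le_antisymm (h ▸ mul_le_mconv_singleton_one ν μ) zero_le)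
    · rw [fourierTransform_mconv, h2, pow_succ]

/-- The Fourier transform of a Haar probability measure is the indicator function of the
identity. -/
theorem fourierTransform_of_isMulLeftInvariant [DiscreteTopology G] [DecidableEq G]
    (μ : Measure (PontryaginDual G)) [IsProbabilityMeasure μ] [μ.IsMulLeftInvariant] (g : G) :
    fourierTransform μ g = if g = 1 then 1 else 0 := by
  split_ifs with hg
  · simp [hg, fourierTransform]
  · obtain ⟨χ, hχ⟩ := PontryaginDual.exists_apply_ne_one hg
    have h := fourierTransform_map_mul_left χ μ g
    rw [map_mul_left_eq_self] at h
    by_contra h0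
    -- Translating by `χ` multiplies the transform at `g` by `χ g ≠ 1` yet leaves `μ` unchanged, so
    -- a nonzero value is impossible.
    refine hχ (Circle.ext ?_)
    rw [Circle.coe_one]
    exact mul_right_cancel₀ h0 (by rw [one_mul, ← h])

/-- A summable function with `b g⁻¹ = star (b g)` can be removed from the Fourier transform of a
finite measure away from the identity without decreasing the measure. -/
theorem exists_measure_fourierTransform_eq_sub [DiscreteTopology G] [Countable G]
    (ν : Measure (PontryaginDual G)) [IsFiniteMeasure ν] (b : G → ℂ)
    (hb : Summable fun g => ‖b g‖) (hstar : ∀ g, b g⁻¹ = star (b g)) :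
    ∃ σ : Measure (PontryaginDual G), IsFiniteMeasure σ ∧ ν ≤ σ ∧
      ∀ g ≠ 1, fourierTransform σ g = fourierTransform ν g - b g := by
  classical
  let m : Measure (PontryaginDual G) :=
    Measure.haarMeasure (⊤ : TopologicalSpace.PositiveCompacts (PontryaginDual G))
  have hm : IsProbabilityMeasure m := ⟨Measure.haarMeasure_self⟩
  let D : PontryaginDual G → ℂ := fun χ => ∑' g, b g * χ g⁻¹
  have hnorm (g : G) (χ : PontryaginDual G) : ‖b g * χ g⁻¹‖ = ‖b g‖ := by
    rw [norm_mul, Circle.norm_coe, mul_one]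
  have hD : Continuous D :=
    continuous_tsum (fun g => continuous_const.mul (PontryaginDual.continuous_coe_apply g⁻¹)) hb
      fun g χ => (hnorm g χ).le
  let c : ℝ := ∑' g, ‖b g‖
  have hDc (χ) : ‖D χ‖ ≤ c := tsum_of_norm_bounded hb.hasSum fun g => (hnorm g χ).le
  -- Conjugation followed by the substitution `g ↦ g⁻¹` returns the same series, by `hstar`.
  have hDreal (χ) : ((D χ).re : ℂ) = D χ := by
    refine Complex.conj_eq_iff_re.1 ?_
    change star (∑' g, b g * χ g⁻¹) = _
    rw [tsum_star, ← (Equiv.inv G).tsum_eq]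
    refine tsum_congr fun g => ?_
    rw [Equiv.inv_apply, star_mul', hstar, star_star, map_inv, map_inv, inv_inv,
      Circle.coe_inv_eq_conj]
    rfl
  have hDint (h : G) : ∫ χ, χ h * D χ ∂m = b h := by
    have hF (g : G) (χ : PontryaginDual G) :
        (χ h : ℂ) * (b g * χ g⁻¹) = b g * χ (h * g⁻¹) := by
      rw [map_mul, Circle.coe_mul]; ring
    have hs := hasSum_integral_of_summable_integral_norm (μ := m)
      (F := fun g (χ : PontryaginDual G) => (χ h : ℂ) * (b g * χ g⁻¹))
      (fun g => by
        simp only [hF]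
        exact (integrable_coe_apply m _).const_mul _)
      (by simpa [norm_mul, Circle.norm_coe] using hb)
    simp only [hF, integral_const_mul] at hs
    change HasSum (fun g => b g * fourierTransform m (h * g⁻¹)) _ at hs
    have h1 : HasSum (fun g => b g * fourierTransform m (h * g⁻¹)) (b h) := by
      convert hasSum_single h ?_ using 1
      · rw [fourierTransform_of_isMulLeftInvariant]; simp
      · intro g hg
        rw [fourierTransform_of_isMulLeftInvariant, if_neg, mul_zero]
        rw [mul_inv_eq_one]
        exact hg.symm
    rw [h1.unique hs]
    refine integral_congr_ae (.of_forall fun χ => ?_)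
    simp only [D, ← hF, tsum_mul_left]
  have hpos (χ) : 0 ≤ c - (D χ).re := by
    linarith [(Complex.re_le_norm (D χ)).trans (hDc χ)]
  -- The constant `c` buys positivity and affects only the Fourier coefficient at the identity,
  -- which the conclusion excludes.
  let w : PontryaginDual G → ENNReal := fun χ => ENNReal.ofReal (c - (D χ).re)
  have hw : Measurable w := by
    have : Continuous fun χ => c - (D χ).re := by fun_prop
    exact this.measurable.ennreal_ofReal
  have hwfin : IsFiniteMeasure (m.withDensity w) := by
    refine isFiniteMeasure_withDensity (ne_of_lt ?_)
    refine (lintegral_mono (g := fun _ => ENNReal.ofReal (c + c)) fun χ => ?_).trans_lt ?_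
    · refine ENNReal.ofReal_le_ofReal ?_
      linarith [(Complex.abs_re_le_norm (D χ)).trans (hDc χ), neg_abs_le (D χ).re]
    · simp
  refine ⟨ν + m.withDensity w, inferInstance, Measure.le_add_right le_rfl, fun g hg => ?_⟩
  rw [fourierTransform_add, sub_eq_add_neg]
  congr 1
  rw [fourierTransform,
    integral_withDensity_eq_integral_toReal_smul hw (.of_forall fun _ => ENNReal.ofReal_lt_top)]
  have h1 (χ : PontryaginDual G) : (w χ).toReal • (χ g : ℂ) = c * χ g - χ g * D χ := by
    rw [ENNReal.toReal_ofReal (hpos χ), Complex.real_smul, Complex.ofReal_sub, hDreal]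
    ring
  have h2 : Integrable (fun χ : PontryaginDual G => χ g * D χ) m :=
    .of_bound ((PontryaginDual.continuous_coe_apply g).mul hD).aestronglyMeasurable c
      (.of_forall fun χ => by
        rw [norm_mul, Circle.norm_coe, one_mul]
        exact hDc χ)
  simp only [h1]
  rw [integral_sub ((integrable_coe_apply m g).const_mul _) h2, hDint, integral_const_mul]
  change c * fourierTransform m g - b g = _
  rw [fourierTransform_of_isMulLeftInvariant, if_neg hg, mul_zero, zero_sub]

end OperatorialRecurrence

/-! ### Atoms coming from eigenvectors. -/

namespace OperatorialRecurrence

section Representation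

variable {G : Type u} [CommGroup G] {H : Type v} [NormedAddCommGroup H] [InnerProductSpace ℂ H]
  [CompleteSpace H]

/-- The cross terms vanish: a unitary having `η` as eigenvector preserves the orthogonal complement
of `η`. -/
theorem matrixCoeff_add_of_inner_eq_zero (π : UnitaryRep G H) (χ : G → Circle) {ζ η : H}
    (hη : ∀ g, (π g : H →L[ℂ] H) η = (χ g : ℂ) • η) (hζ : inner ℂ η ζ = 0) (g : G) :
    matrixCoeff π (ζ + η) g = matrixCoeff π ζ g + (‖η‖ ^ 2 : ℝ) * χ g := by
  have h1 : inner ℂ η ((π g : H →L[ℂ] H) ζ) = 0 := by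
    have h := Unitary.inner_map_map (π g) η ζ
    rw [hη, inner_smul_left, hζ] at h
    exact (mul_eq_zero.1 h).resolve_left (by simp)
  have h2 : inner ℂ ζ η = 0 := by rw [← inner_conj_symm, hζ, map_zero]
  simp only [matrixCoeff, map_add, inner_add_left, inner_add_right, hη, inner_smul_right, h1, h2,
    inner_self_eq_norm_sq_to_K]
  push_cast
  simp
  ring

/-- A vector not orthogonal to a `χ`-eigenvector has a spectral measure with an atom at `χ`. -/
theorem exists_spectralMeasure_singleton_ne_zero [TopologicalSpace G] [DiscreteTopology G]
    (π : UnitaryRep G H) (χ : PontryaginDual G) {ξ η : H}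
    (hη : ∀ g, (π g : H →L[ℂ] H) η = (χ g : ℂ) • η) (hξ : inner ℂ ξ η ≠ 0) :
    ∃ μ : Measure (PontryaginDual G), IsFiniteMeasure μ ∧ μ {χ} ≠ 0 ∧
      ∀ g, fourierTransform μ g = matrixCoeff π ξ g := by
  have hη0 : inner ℂ η η ≠ 0 := fun h => hξ (by rw [inner_self_eq_zero.1 h, inner_zero_right])
  have hξ' : inner ℂ η ξ ≠ 0 := fun h => hξ (by rw [← inner_conj_symm, h, map_zero])
  let a : ℂ := inner ℂ η ξ / inner ℂ η η
  have ha : a ≠ 0 := div_ne_zero hξ' hη0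
  have haη : a • η ≠ 0 := smul_ne_zero ha fun h => hη0 (by rw [h, inner_zero_left])
  have horth : inner ℂ (a • η) (ξ - a • η) = 0 := by
    rw [inner_smul_left, inner_sub_right, inner_smul_right, div_mul_cancel₀ _ hη0, sub_self,
      mul_zero]
  obtain ⟨μ, _, hμ⟩ := exists_spectralMeasure π (ξ - a • η)
  -- The atom is put in by hand: a point mass for the component of `ξ` along `η`, plus a spectral
  -- measure of the orthogonal remainder.
  refine ⟨μ + ENNReal.ofReal (‖a • η‖ ^ 2) • Measure.dirac χ, ?_, ?_, fun g => ?_⟩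
  · have := Measure.smul_finite (Measure.dirac χ) (ENNReal.ofReal_ne_top (r := ‖a • η‖ ^ 2))
    infer_instance
  · have : 0 < ‖a • η‖ ^ 2 := by positivity
    intro h
    rw [Measure.add_apply, add_eq_zero, Measure.smul_apply,
      Measure.dirac_apply_of_mem (Set.mem_singleton χ),
      smul_eq_mul, mul_one, ENNReal.ofReal_eq_zero] at h
    exact this.not_ge h.2
  · have := Measure.smul_finite (Measure.dirac χ) (ENNReal.ofReal_ne_top (r := ‖a • η‖ ^ 2))
    rw [fourierTransform_add, fourierTransform_smul, fourierTransform_dirac, hμ,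
      ENNReal.toReal_ofReal (by positivity),
      ← matrixCoeff_add_of_inner_eq_zero π χ (fun g => by rw [map_smul, hη, smul_comm]) horth,
      sub_add_cancel]

end Representation

/-! ### From a summable transform to a vanishing one. -/

variable {G : Type u} [CommGroup G] [TopologicalSpace G]

theorem exists_isProbabilityMeasure_smul (μ : Measure (PontryaginDual G)) [IsFiniteMeasure μ]
    {s : Set (PontryaginDual G)} (hs : μ s ≠ 0) :
    ∃ (ν : Measure (PontryaginDual G)) (r : ℝ), IsProbabilityMeasure ν ∧ ν s ≠ 0 ∧
      ∀ g, fourierTransform ν g = r * fourierTransform μ g := by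
  have : NeZero μ := ⟨fun h => hs (by simp [h])⟩
  refine ⟨(μ Set.univ)⁻¹ • μ, _, isProbabilityMeasureSMul, ?_, fourierTransform_smul _ μ⟩
  simp [hs]

/-- A measure with an atom and with `p`-summable Fourier transform on `V` gives rise to a
probability measure with an atom at the trivial character whose Fourier transform vanishes
on `V`. -/
theorem exists_measure_fourierTransform_eq_zero [DiscreteTopology G] [Countable G] {V : Set G}
    (hV : (1 : G) ∉ V) (μ : Measure (PontryaginDual G)) [IsFiniteMeasure μ] {p : ℕ}
    (hp : Summable fun g : V => ‖fourierTransform μ (g : G)‖ ^ p) {χ : PontryaginDual G}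
    (hχ : μ {χ} ≠ 0) :
    ∃ σ : Measure (PontryaginDual G), IsProbabilityMeasure σ ∧ σ {1} ≠ 0 ∧
      ∀ g ∈ V, fourierTransform σ g = 0 := by
  have hχ' : μ.map (χ⁻¹ * ·) {1} ≠ 0 := by
    rw [Measure.map_apply (continuous_const_mul _).measurable (measurableSet_singleton _)]
    convert hχ
    ext ψ
    simp [eq_comm]
  obtain ⟨ν, _, hν1, hν⟩ := exists_fourierTransform_eq_pow _ hχ' p
  have hnorm (g : G) : ‖fourierTransform ν g‖ = ‖fourierTransform μ g‖ ^ p := by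
    rw [hν, fourierTransform_map_mul_left, norm_pow, norm_mul, Circle.norm_coe, one_mul]
  -- Symmetrizing `V` gives `b g⁻¹ = star (b g)`, which makes the correcting density real.
  let b : G → ℂ := (V ∪ V⁻¹).indicator (fourierTransform ν)
  have hVs : Summable (V.indicator fun g => ‖fourierTransform ν g‖) := by
    rw [← summable_subtype_iff_indicator]
    simpa only [Function.comp_def, hnorm] using hp
  have hb : Summable fun g => ‖b g‖ := by
    refine .of_nonneg_of_le (fun _ => norm_nonneg _) (fun g => ?_)
      (hVs.add ((Equiv.inv G).summable_iff.2 hVs))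
    have h0 (g : G) : 0 ≤ V.indicator (fun g => ‖fourierTransform ν g‖) g :=
      Set.indicator_nonneg (fun _ _ => norm_nonneg _) g
    have hinv : ‖fourierTransform ν g⁻¹‖ = ‖fourierTransform ν g‖ := by
      rw [fourierTransform_inv, norm_star]
    by_cases h1 : g ∈ V
    · simpa [b, h1] using h0 g⁻¹
    · by_cases h2 : g⁻¹ ∈ V
      · simp [b, h1, h2, hinv]
      · simp [b, h1, h2]
  have hstar (g : G) : b g⁻¹ = star (b g) := by
    have : g⁻¹ ∈ V ∪ V⁻¹ ↔ g ∈ V ∪ V⁻¹ := by simp [or_comm]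
    by_cases h : g ∈ V ∪ V⁻¹
    · simp only [b, Set.indicator_of_mem h, Set.indicator_of_mem (this.2 h), fourierTransform_inv]
    · simp only [b, Set.indicator_of_notMem h, Set.indicator_of_notMem (mt this.1 h), star_zero]
  obtain ⟨σ, _, hσ, hσb⟩ := exists_measure_fourierTransform_eq_sub ν b hb hstar
  obtain ⟨τ, r, hτ, hτ1, hτσ⟩ := exists_isProbabilityMeasure_smul σ (s := {1})
    fun h => hν1 (le_antisymm (h ▸ hσ _) zero_le)
  refine ⟨τ, hτ, hτ1, fun g hg => ?_⟩
  -- The correction fails only at the identity, which `hV` keeps out of `V`.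
  rw [hτσ, hσb g fun h => hV (h ▸ hg)]
  simp [b, hg]

end OperatorialRecurrence

/-! ### The cycle of implications. -/

theorem mainTheorem5 (G : Type u) [CommGroup G] [TopologicalSpace G] [DiscreteTopology G]
    [Countable G] [Infinite G] (V : Set G) (hV : (1 : G) ∉ V) :
    List.TFAE [
      OperatorialRecurrence.IsSetOfOperatorialRecurrence.{u, v} V,
      ∀ (μ : MeasureTheory.Measure (PontryaginDual G)) [MeasureTheory.IsProbabilityMeasure μ],
        (∀ g ∈ V, OperatorialRecurrence.fourierTransform μ g = 0) →
          μ {(1 : PontryaginDual G)} = 0,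
      ∀ (H : Type v) [NormedAddCommGroup H] [InnerProductSpace ℂ H] [CompleteSpace H]
        (π : OperatorialRecurrence.UnitaryRep G H) (ξ : H),
        (∃ p : ℕ, 1 ≤ p ∧
          Summable fun g : V => ‖OperatorialRecurrence.matrixCoeff π ξ (g : G)‖ ^ p) →
          ∀ η : H, OperatorialRecurrence.IsEigenvector π η → inner ℂ ξ η = 0,
      ∀ (μ : MeasureTheory.Measure (PontryaginDual G)) [MeasureTheory.IsProbabilityMeasure μ],
        (∃ p : ℕ, 1 ≤ p ∧
          Summable fun g : V => ‖OperatorialRecurrence.fourierTransform μ (g : G)‖ ^ p) →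
          ∀ χ : PontryaginDual G, μ {χ} = 0] := by
  tfae_have 1 → 2 := by
    intro h μ _ hμ
    obtain ⟨H, _, _, _, π, ξ, η, h1, h2, h3⟩ := exists_unitaryRep_matrixCoeff_eq.{u, v} μ
    have h4 := h H π ξ (fun g hg => (h1 g).trans (hμ g hg)) η h2
    rw [h3, Complex.ofReal_eq_zero] at h4
    exact (measureReal_eq_zero_iff).1 h4
  tfae_have 2 → 4 := by
    rintro h μ _ ⟨p, -, hp⟩ χ
    by_contra hχ
    obtain ⟨σ, _, hσ1, hσ⟩ := exists_measure_fourierTransform_eq_zero hV μ hp hχ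
    exact hσ1 (h σ hσ)
  tfae_have 4 → 3 := by
    rintro h H _ _ _ π ξ ⟨p, hp1, hp⟩ η ⟨-, χ, hη⟩
    by_contra hξ
    obtain ⟨μ, _, hμχ, hμ⟩ := exists_spectralMeasure_singleton_ne_zero π χ hη hξ
    obtain ⟨ν, r, _, hνχ, hν⟩ := exists_isProbabilityMeasure_smul μ hμχ
    refine hνχ (h ν ⟨p, hp1, ?_⟩ χ)
    simpa only [hν, hμ, norm_mul, mul_pow] using hp.mul_left _
  tfae_have 3 → 1 := by
    intro h H _ _ _ π ξ hξ η hη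
    by_cases hη0 : η = 0
    · rw [hη0, inner_zero_right]
    · refine h H π ξ ⟨1, le_rfl, ?_⟩ η ⟨hη0, 1, fun g => ?_⟩
      · simp only [hξ _ (Subtype.prop _), norm_zero, pow_one]
        exact summable_zero
      · simpa using hη g
  tfae_finish
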